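/- Let $G=(V,E)$ be a finite connected simple graph with at least two vertices (agents), let $N(i)$ be the set of neighbours of $i\in V$, and let $\alpha\in(0,1)$. Consider the following urn process. A state $\theta$ is drawn from a two-element set (with an arbitrary prior). Given $\theta$, the agents receive independent signals in that set, each equal to $\theta$ with probability $\alpha$ and different from $\theta$ with probability $1-\alpha$. The urn of agent $i$ contains at time $0$ a single ball, which is white if the signal of $i$ equals $\theta$ and black otherwise. At each stage every agent draws one ball uniformly at random from its own urn, with replacement; given the past, the draws of the different agents are independent. Then each agent $i$ adds to its urn, for each neighbour $j\in N(i)$, one ball of the colour drawn by $j$. Let $Z_i^t\in[0,1]$ be the proportion of black balls in the urn of agent $i$ at time $t$. Then there is a real random variable $\bar Z$ such that, almost surely, $\lim_{t\to\infty}Z_i^t=\bar Z$ for all $i\in V$ simultaneously. This common limit is non-degenerate (it is not almost surely equal to a constant), and its law has full support on $[0,1]$: the topological support of the law of $\bar Z$ is exactly $[0,1]$. -/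

import Mathlib

open MeasureTheory Filter Topology Set

namespace OpinionUrns

/-- Number of balls of colour `c` in the urn of agent `i` at time `t` (`true` is black, `false` is
white). The urn of `i` starts with one ball, of colour `init i`; `draw t j` is the colour of the
ball which agent `j` draws from its time-`t` urn (and puts back). Every agent then adds, for each of
its neighbours, one ball of the colour drawn by that neighbour, which gives the urns at time
`t + 1`. -/
def balls {V : Type*} [Fintype V] (G : SimpleGraph V) [DecidableRel G.Adj]
    (init : V → Bool) (draw : ℕ → V → Bool) (c : Bool) : ℕ → V → ℕ
  | 0, i => if init i = c then 1 else 0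
  | t + 1, i => balls G init draw c t i +
      ((G.neighborFinset i).filter (fun j => draw t j = c)).card

/-- Proportion of black balls in the urn of agent `i` at time `t`. It depends only on the initial
colours and on `draw k` for `k < t`. -/
noncomputable def blackProportion {V : Type*} [Fintype V] (G : SimpleGraph V) [DecidableRel G.Adj]
    (init : V → Bool) (draw : ℕ → V → Bool) (t : ℕ) (i : V) : ℝ :=
  (balls G init draw true t i : ℝ) /
    ((balls G init draw true t i : ℝ) + (balls G init draw false t i : ℝ))

/-- Initial colours: the ball of agent `i` is black exactly when the signal of `i` is not the true
state `s`. -/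
def initialColour {V : Type*} (s : Bool) (signal : V → Bool) (i : V) : Bool :=
  decide (signal i ≠ s)

/-- `θ` is the state of the world, `σ` the vector of private signals and `X t` the vector of draws
from the urns of time `t`, in the communication process on `G` with signal accuracy `α`. The prior
of `θ` is arbitrary. -/
structure IsUrnProcess {V Ω : Type*} [Fintype V] [MeasurableSpace Ω] (G : SimpleGraph V)
    [DecidableRel G.Adj] (α : ℝ) (μ : Measure Ω)
    (θ : Ω → Bool) (σ : Ω → V → Bool) (X : ℕ → Ω → V → Bool) : Prop where
  measurable_state : Measurable θ
  measurable_signal : Measurable σ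
  measurable_draw : ∀ t, Measurable (X t)
  /-- Given the state, the signals are independent and each is correct with probability `α`. -/
  signal_law : ∀ (s : Bool) (c : V → Bool),
    μ.real {ω | θ ω = s ∧ σ ω = c} =
      μ.real {ω | θ ω = s} * ∏ i, (if c i = s then α else 1 - α)
  /-- Given the state, the signals and all earlier draws, the draws at time `t` are independent
  and agent `i` draws black with probability the proportion of black balls in its urn. -/
  draw_law : ∀ (t : ℕ) (s : Bool) (c : V → Bool) (h : ℕ → V → Bool),
    μ.real {ω | θ ω = s ∧ σ ω = c ∧ ∀ k ≤ t, X k ω = h k} =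
      μ.real {ω | θ ω = s ∧ σ ω = c ∧ ∀ k < t, X k ω = h k} *
        ∏ i, (if h t i = true then blackProportion G (initialColour s c) h t i
          else 1 - blackProportion G (initialColour s c) h t i)

/-- The proportion `Z_i^t` of black balls in the urn of agent `i` at time `t`. -/
noncomputable def belief {V Ω : Type*} [Fintype V] (G : SimpleGraph V) [DecidableRel G.Adj]
    (θ : Ω → Bool) (σ : Ω → V → Bool) (X : ℕ → Ω → V → Bool) (t : ℕ) (i : V) (ω : Ω) : ℝ :=
  blackProportion G (initialColour (θ ω) (σ ω)) (fun k => X k ω) t i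

end OpinionUrns

/-! Write `d i` for the degrees and `z` for the vector of black proportions at time `t`. The
increment of `d i * z i` is `1 / (t + 1)` times the sum of `x j - z i` over the neighbours `j` of
`i`, where `x j` is the draw of `j`, up to an error of order `1 / t ^ 2`. Given the past, `x j` has
mean `z j`.

Consensus: weighting by degrees and exchanging the two ends of each edge makes `mass` a martingale
up to summable errors, while `sqMass` loses `energy / (t + 1)` in mean. Both therefore converge
almost surely, and the expected energies are summable against the harmonic weights. On a connected
graph the energy dominates the degree-weighted variance, whose limit exists and so must vanish
(`ae_tendsto_sum_sq_sub`); all proportions then follow the weighted mean.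

Full support: for each `x` in `[0, 1]` and each `t`, with positive probability all proportions are
within `4 / t` of `x` at time `t` (`exists_measurableSet_pos`). From there the mean square distance
of `mass` to `volume * x` grows by only `O(1 / t)` over the whole future (`setIntegral_le`), so for
large `t` the limit cannot almost surely stay `ε` away from `x`. Non-degeneracy follows by taking `x
= 0` and `x = 1`. -/

namespace OpinionUrns

/-! ### Pathwise one-step estimates for degree-weighted potentials. -/

section Deterministic

variable {V : Type*} [Fintype V] (G : SimpleGraph V) [DecidableRel G.Adj]

/-- The number of black balls added by a draw of the given colour. -/
def blackValue (b : Bool) : ℝ := if b = true then 1 else 0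

lemma blackValue_mem_Icc (b : Bool) : blackValue b ∈ Icc (0 : ℝ) 1 := by
  cases b <;> simp [blackValue]

lemma balls_congr (init : V → Bool) {h h' : ℕ → V → Bool} (c : Bool) (t : ℕ)
    (hh : ∀ k < t, h k = h' k) (i : V) : balls G init h c t i = balls G init h' c t i := by
  induction t with
  | zero => rfl
  | succ t ih =>
    simp only [balls]
    rw [ih fun k hk => hh k (hk.trans t.lt_succ_self), hh t t.lt_succ_self]

lemma blackProportion_congr (init : V → Bool) {h h' : ℕ → V → Bool} (t : ℕ)
    (hh : ∀ k < t, h k = h' k) (i : V) :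
    blackProportion G init h t i = blackProportion G init h' t i := by
  simp only [blackProportion, balls_congr G init _ t hh]

lemma balls_true_succ (init : V → Bool) (h : ℕ → V → Bool) (t : ℕ) (i : V) :
    (balls G init h true (t + 1) i : ℝ) =
      balls G init h true t i + ∑ j ∈ G.neighborFinset i, blackValue (h t j) := by
  simp only [balls, blackValue, Nat.cast_add, Finset.sum_boole]

lemma balls_true_add_balls_false (init : V → Bool) (h : ℕ → V → Bool) (t : ℕ) (i : V) :
    balls G init h true t i + balls G init h false t i = 1 + G.degree i * t := by
  induction t with
  | zero => cases hi : init i <;> simp [balls, hi]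
  | succ t ih =>
    have := Finset.card_filter_add_card_filter_not (s := G.neighborFinset i)
      (fun j => h t j = true)
    simp only [Bool.not_eq_true, SimpleGraph.card_neighborFinset_eq_degree] at this
    simp only [balls]
    linarith

lemma blackProportion_eq_div (init : V → Bool) (h : ℕ → V → Bool) (t : ℕ) (i : V) :
    blackProportion G init h t i = balls G init h true t i / (1 + G.degree i * t) := by
  rw [blackProportion]
  congr 1
  exact_mod_cast balls_true_add_balls_false G init h t i

lemma blackProportion_mem_Icc (init : V → Bool) (h : ℕ → V → Bool) (t : ℕ) (i : V) :
    blackProportion G init h t i ∈ Icc (0 : ℝ) 1 := by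
  rw [blackProportion]
  exact ⟨by positivity, div_le_one_of_le₀ (by simp) (by positivity)⟩

lemma blackProportion_succ (init : V → Bool) (h : ℕ → V → Bool) (t : ℕ) (i : V) :
    (1 + G.degree i * (t + 1)) * blackProportion G init h (t + 1) i =
      (1 + G.degree i * t) * blackProportion G init h t i +
        ∑ j ∈ G.neighborFinset i, blackValue (h t j) := by
  rw [blackProportion_eq_div, blackProportion_eq_div, mul_div_cancel₀ _ (by positivity),
    ← balls_true_succ]
  push_cast
  rw [mul_div_cancel₀ _ (by positivity)]

/-- The sum of the degrees. -/
def volume : ℝ := ∑ i, (G.degree i : ℝ)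

/-- The sum of a function on the vertices, weighted by the degrees. -/
def mass (z : V → ℝ) : ℝ := ∑ i, G.degree i * z i

/-- The sum of the squares of a function on the vertices, weighted by the degrees. -/
def sqMass (z : V → ℝ) : ℝ := ∑ i, G.degree i * z i ^ 2

/-- The Dirichlet energy, each edge being counted twice. -/
def energy (z : V → ℝ) : ℝ := ∑ i, ∑ j ∈ G.neighborFinset i, (z i - z j) ^ 2

lemma sum_neighborFinset_comm (F : V → V → ℝ) :
    ∑ i, ∑ j ∈ G.neighborFinset i, F i j = ∑ i, ∑ j ∈ G.neighborFinset i, F j i := by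
  refine Finset.sum_comm' fun i j => ?_
  simp [G.adj_comm]

lemma sum_neighborFinset_right (f : V → ℝ) :
    ∑ i, ∑ j ∈ G.neighborFinset i, f j = ∑ i, G.degree i * f i := by
  rw [sum_neighborFinset_comm]
  simp

lemma energy_eq (z : V → ℝ) :
    energy G z = 2 * sqMass G z - 2 * ∑ i, z i * ∑ j ∈ G.neighborFinset i, z j := by
  have h1 : energy G z = ∑ i, ∑ j ∈ G.neighborFinset i, z i ^ 2 +
      ∑ i, ∑ j ∈ G.neighborFinset i, z j ^ 2 -
        2 * ∑ i, ∑ j ∈ G.neighborFinset i, z i * z j := by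
    simp only [energy, Finset.mul_sum, ← Finset.sum_add_distrib, ← Finset.sum_sub_distrib]
    exact Finset.sum_congr rfl fun i _ => Finset.sum_congr rfl fun j _ => by ring
  rw [h1, sum_neighborFinset_right G fun j => z j ^ 2]
  simp only [Finset.sum_const, SimpleGraph.card_neighborFinset_eq_degree, nsmul_eq_mul, sqMass,
    ← Finset.mul_sum]
  ring

lemma energy_nonneg (z : V → ℝ) : 0 ≤ energy G z :=
  Finset.sum_nonneg fun _ _ => Finset.sum_nonneg fun _ _ => sq_nonneg _

lemma volume_nonneg : 0 ≤ volume G := Finset.sum_nonneg fun _ _ => Nat.cast_nonneg _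

lemma mass_mem_Icc {z : V → ℝ} (hz : ∀ i, z i ∈ Icc (0 : ℝ) 1) :
    mass G z ∈ Icc 0 (volume G) :=
  ⟨Finset.sum_nonneg fun i _ => mul_nonneg (Nat.cast_nonneg _) (hz i).1,
    Finset.sum_le_sum fun i _ => mul_le_of_le_one_right (Nat.cast_nonneg _) (hz i).2⟩

lemma sqMass_mem_Icc {z : V → ℝ} (hz : ∀ i, z i ∈ Icc (0 : ℝ) 1) :
    sqMass G z ∈ Icc 0 (volume G) :=
  ⟨Finset.sum_nonneg fun i _ => by positivity,
    Finset.sum_le_sum fun i _ => mul_le_of_le_one_right (Nat.cast_nonneg _)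
      (pow_le_one₀ (hz i).1 (hz i).2)⟩

/-- The variance identity for the weights given by the degrees. -/
lemma sum_degree_mul_degree_mul_sq_sub (z : V → ℝ) :
    ∑ i, ∑ j, (G.degree i : ℝ) * G.degree j * (z i - z j) ^ 2 =
      2 * volume G * sqMass G z - 2 * mass G z ^ 2 := by
  have h : ∀ i j : V, (G.degree i : ℝ) * G.degree j * (z i - z j) ^ 2 =
      (G.degree i * z i ^ 2) * G.degree j + G.degree i * (G.degree j * z j ^ 2) -
        2 * ((G.degree i * z i) * (G.degree j * z j)) := fun i j => by ring
  simp only [h, Finset.sum_add_distrib, Finset.sum_sub_distrib, ← Finset.mul_sum,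
    ← Finset.sum_mul]
  simp only [volume, sqMass, mass]
  ring

/-- In a connected graph the Dirichlet energy controls all differences. -/
lemma exists_sq_sub_le_mul_energy (hG : G.Connected) (i j : V) :
    ∃ C : ℝ, 0 ≤ C ∧ ∀ z : V → ℝ, (z i - z j) ^ 2 ≤ C * energy G z := by
  obtain ⟨w⟩ := hG.preconnected i j
  induction w with
  | nil => exact ⟨0, le_rfl, fun z => by simp⟩
  | @cons u v w huv _ ih =>
    obtain ⟨C, hC, h⟩ := ih
    -- From `(a + b) ^ 2 ≤ 2 * a ^ 2 + 2 * b ^ 2`: the first edge of the walk costs at most the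
    -- whole energy, the rest at most `C` times it.
    refine ⟨2 + 2 * C, by positivity, fun z => ?_⟩
    have h1 : (z u - z v) ^ 2 ≤ energy G z :=
      (Finset.single_le_sum (f := fun j => (z u - z j) ^ 2) (fun _ _ => sq_nonneg _)
        (by simpa using huv)).trans
      (Finset.single_le_sum (f := fun i => ∑ j ∈ G.neighborFinset i, (z i - z j) ^ 2)
        (fun _ _ => Finset.sum_nonneg fun _ _ => sq_nonneg _) (Finset.mem_univ u))
    nlinarith [h z, sq_nonneg ((z u - z v) - (z v - z w))]

lemma exists_sum_sq_sub_le_mul_energy (hG : G.Connected) :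
    ∃ C : ℝ, 0 ≤ C ∧ ∀ z : V → ℝ,
      ∑ i, ∑ j, (G.degree i : ℝ) * G.degree j * (z i - z j) ^ 2 ≤ C * energy G z := by
  choose C hC h using exists_sq_sub_le_mul_energy G hG
  refine ⟨∑ i, ∑ j, (G.degree i : ℝ) * G.degree j * C i j, ?_, fun z => ?_⟩
  · exact Finset.sum_nonneg fun i _ => Finset.sum_nonneg fun j _ => by have := hC i j; positivity
  · simp only [Finset.sum_mul]
    refine Finset.sum_le_sum fun i _ => Finset.sum_le_sum fun j _ => ?_
    rw [mul_assoc _ (C i j)]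
    exact mul_le_mul_of_nonneg_left (h i j z) (by positivity)

/-- `z` and `z'` are the proportions of black balls at the times `t` and `t + 1`, when agent `j`
draws `x j` black balls from its time-`t` urn. -/
structure IsStep (t : ℕ) (z z' x : V → ℝ) : Prop where
  mem_Icc : ∀ i, z i ∈ Icc (0 : ℝ) 1
  draw_mem_Icc : ∀ i, x i ∈ Icc (0 : ℝ) 1
  eq : ∀ i, (1 + G.degree i * (t + 1)) * z' i =
    (1 + G.degree i * t) * z i + ∑ j ∈ G.neighborFinset i, x j

variable {G} {t : ℕ} {z z' x : V → ℝ}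

namespace IsStep

lemma abs_sum_sub_le (h : IsStep G t z z' x) (i : V) :
    |∑ j ∈ G.neighborFinset i, x j - G.degree i * z i| ≤ G.degree i := by
  have h0 : 0 ≤ ∑ j ∈ G.neighborFinset i, x j :=
    Finset.sum_nonneg fun j _ => (h.draw_mem_Icc j).1
  have h1 : ∑ j ∈ G.neighborFinset i, x j ≤ G.degree i := by
    simpa using Finset.sum_le_card_nsmul (G.neighborFinset i) x 1 fun j _ => (h.draw_mem_Icc j).2
  have h2 := (h.mem_Icc i).1
  have h3 := (h.mem_Icc i).2
  have h4 : (G.degree i : ℝ) * z i ≤ G.degree i := mul_le_of_le_one_right (Nat.cast_nonneg _) h3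
  have h5 : 0 ≤ (G.degree i : ℝ) * z i := mul_nonneg (Nat.cast_nonneg _) h2
  exact abs_le.2 ⟨by linarith, by linarith⟩

lemma mul_sub_eq (h : IsStep G t z z' x) (i : V) :
    (1 + G.degree i * ((t : ℝ) + 1)) * (z' i - z i) =
      ∑ j ∈ G.neighborFinset i, x j - G.degree i * z i := by
  linear_combination h.eq i

lemma abs_sub_le (h : IsStep G t z z' x) (i : V) : |z' i - z i| ≤ 1 / ((t : ℝ) + 1) := by
  have h1 := h.abs_sum_sub_le i
  have hp : (0 : ℝ) < 1 + G.degree i * ((t : ℝ) + 1) := by positivity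
  rw [← h.mul_sub_eq, abs_mul, abs_of_pos hp] at h1
  rw [le_div_iff₀ (by positivity)]
  by_cases hd : (G.degree i : ℝ) = 0
  · have : |z' i - z i| = 0 := le_antisymm (by simpa [hd] using h1) (abs_nonneg _)
    simp [this]
  · have hd' : (0 : ℝ) < G.degree i := lt_of_le_of_ne (Nat.cast_nonneg _) (Ne.symm hd)
    have := abs_nonneg (z' i - z i)
    by_contra! hc
    nlinarith

/-- The initial ball is all that separates the urn size `1 + d * (t + 1)` from `d * (t + 1)`;
dropping it costs exactly `(z' i - z i) / (t + 1)`. The factor `d` in the bound lets the errors sum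
to `volume`; an isolated vertex never moves. -/
lemma abs_error_le (h : IsStep G t z z' x) (i : V) :
    |G.degree i * (z' i - z i) -
      1 / ((t : ℝ) + 1) * (∑ j ∈ G.neighborFinset i, x j - G.degree i * z i)| ≤
        G.degree i * (1 / ((t : ℝ) + 1)) ^ 2 := by
  have h0 : G.degree i * (z' i - z i) -
      1 / ((t : ℝ) + 1) * (∑ j ∈ G.neighborFinset i, x j - G.degree i * z i) =
        -(1 / ((t : ℝ) + 1)) * (z' i - z i) := by
    rw [← h.mul_sub_eq]
    field_simp
    ring
  have h1 := h.abs_sub_le i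
  rw [h0, abs_mul, abs_neg, abs_of_pos (by positivity)]
  by_cases hd : G.degree i = 0
  · have h2 := h.mul_sub_eq i
    have h3 : G.neighborFinset i = ∅ := by rwa [← Finset.card_eq_zero]
    rw [h3, hd] at h2
    have : z' i - z i = 0 := by simpa using h2
    simp [this, hd]
  · have hd' : (1 : ℝ) ≤ G.degree i := by exact_mod_cast Nat.one_le_iff_ne_zero.2 hd
    calc 1 / ((t : ℝ) + 1) * |z' i - z i| ≤ 1 / ((t : ℝ) + 1) * (1 / ((t : ℝ) + 1)) := by gcongr
      _ = 1 * (1 / ((t : ℝ) + 1)) ^ 2 := by ring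
      _ ≤ _ := by gcongr

/-- Double counting edges turns the sum over `i` of the neighbours' draws into the sum of `d j * x
j`, so each draw is compared with the proportion in its own urn and the main term has conditional
mean zero. -/
lemma mass_sub (h : IsStep G t z z' x) :
    |mass G z' - mass G z - ∑ j, 1 / ((t : ℝ) + 1) * G.degree j * (x j - z j)| ≤
      volume G * (1 / ((t : ℝ) + 1)) ^ 2 := by
  have h1 : mass G z' - mass G z - ∑ j, 1 / ((t : ℝ) + 1) * G.degree j * (x j - z j) =
      ∑ i, (G.degree i * (z' i - z i) -
        1 / ((t : ℝ) + 1) * (∑ j ∈ G.neighborFinset i, x j - G.degree i * z i)) := by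
    rw [Finset.sum_sub_distrib, ← Finset.mul_sum, Finset.sum_sub_distrib,
      sum_neighborFinset_right]
    simp only [mass, mul_sub, Finset.sum_sub_distrib, mul_assoc, ← Finset.mul_sum]
  rw [h1, volume, Finset.sum_mul]
  exact (Finset.abs_sum_le_sum_abs _ _).trans (Finset.sum_le_sum fun i _ => h.abs_error_le i)

lemma mass_le (h : IsStep G t z z' x) :
    mass G z' ≤ mass G z + ∑ j, 1 / ((t : ℝ) + 1) * G.degree j * (x j - z j) +
      volume G * (1 / ((t : ℝ) + 1)) ^ 2 := by
  linarith [(abs_le.1 h.mass_sub).2]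

/-- Expand the square around `mass G z - y`. Of the constant 3, one unit is the squared increment
and two come from the cross term with the error of `mass_sub`. -/
lemma mass_sub_sq_le (h : IsStep G t z z' x) {y : ℝ} (hy : y ∈ Icc 0 (volume G)) :
    (mass G z' - y) ^ 2 ≤ (mass G z - y) ^ 2 +
      ∑ j, 2 * (1 / ((t : ℝ) + 1)) * (mass G z - y) * G.degree j * (x j - z j) +
        3 * volume G ^ 2 * (1 / ((t : ℝ) + 1)) ^ 2 := by
  set r : ℝ := 1 / ((t : ℝ) + 1)
  have hr : 0 ≤ r := by positivity
  have hD := volume_nonneg G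
  have h1 : |mass G z' - mass G z| ≤ volume G * r := by
    simp only [mass, volume, ← Finset.sum_sub_distrib, Finset.sum_mul, ← mul_sub]
    refine (Finset.abs_sum_le_sum_abs _ _).trans (Finset.sum_le_sum fun i _ => ?_)
    rw [abs_mul, Nat.abs_cast]
    exact mul_le_mul_of_nonneg_left (h.abs_sub_le i) (Nat.cast_nonneg _)
  have h2 : (mass G z' - mass G z) ^ 2 ≤ (volume G * r) ^ 2 := sq_le_sq' (abs_le.1 h1).1
    (abs_le.1 h1).2
  set e := mass G z' - mass G z - ∑ j, r * G.degree j * (x j - z j)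
  have he : |e| ≤ volume G * r ^ 2 := h.mass_sub
  have hm : |mass G z - y| ≤ volume G := by
    have := mass_mem_Icc G h.mem_Icc
    exact abs_le.2 ⟨by linarith [this.1, hy.2], by linarith [this.2, hy.1]⟩
  have h3 : (mass G z - y) * e ≤ volume G * (volume G * r ^ 2) :=
    (le_abs_self _).trans (by rw [abs_mul]; gcongr)
  have h4 : ∑ j, 2 * r * (mass G z - y) * G.degree j * (x j - z j) =
      2 * (mass G z - y) * (mass G z' - mass G z - e) := by
    simp only [e, sub_sub_cancel, Finset.mul_sum]
    exact Finset.sum_congr rfl fun j _ => by ring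
  rw [h4]
  nlinarith

/-- Replacing the draws by their conditional means in the cross term `2 * z i * (z' i - z i)`
leaves, by `energy_eq`, exactly `-energy / (t + 1)`. The remainder is linear in `x j - z j`, after
exchanging the ends of the edges. -/
lemma sqMass_le (h : IsStep G t z z' x) :
    sqMass G z' ≤ sqMass G z - 1 / ((t : ℝ) + 1) * energy G z +
      ∑ j, 2 * (1 / ((t : ℝ) + 1)) * (∑ i ∈ G.neighborFinset j, z i) * (x j - z j) +
        3 * volume G * (1 / ((t : ℝ) + 1)) ^ 2 := by
  set r : ℝ := 1 / ((t : ℝ) + 1)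
  have h1 : ∀ i, G.degree i * z' i ^ 2 ≤ G.degree i * z i ^ 2 +
      2 * r * (z i * ∑ j ∈ G.neighborFinset i, x j) - 2 * r * (G.degree i * z i ^ 2) +
        3 * G.degree i * r ^ 2 := by
    intro i
    have hd : (0 : ℝ) ≤ G.degree i := Nat.cast_nonneg _
    have ha := h.abs_sub_le i
    have hb := abs_le.1 (h.abs_error_le i)
    have hz := h.mem_Icc i
    have h2 : (z' i - z i) ^ 2 ≤ r ^ 2 := sq_le_sq' (abs_le.1 ha).1 (abs_le.1 ha).2
    have h3 : G.degree i * (z' i - z i) ^ 2 ≤ G.degree i * r ^ 2 := by gcongr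
    have h4 := mul_le_mul_of_nonneg_left hb.2 hz.1
    have h5 : z i * (G.degree i * r ^ 2) ≤ 1 * (G.degree i * r ^ 2) := by
      gcongr
      exact hz.2
    have h6 : (G.degree i : ℝ) * z' i ^ 2 = G.degree i * z i ^ 2 +
        2 * (z i * (G.degree i * (z' i - z i))) + G.degree i * (z' i - z i) ^ 2 := by ring
    rw [h6]
    linarith
  have h2 : ∑ i, z i * ∑ j ∈ G.neighborFinset i, x j =
      ∑ j, (∑ i ∈ G.neighborFinset j, z i) * x j := by
    simp only [Finset.mul_sum, Finset.sum_mul]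
    exact sum_neighborFinset_comm G fun i j => z i * x j
  have h3 : ∑ i, z i * ∑ j ∈ G.neighborFinset i, z j =
      ∑ j, (∑ i ∈ G.neighborFinset j, z i) * z j :=
    Finset.sum_congr rfl fun i _ => mul_comm _ _
  have h4 := Finset.sum_le_sum fun i (_ : i ∈ Finset.univ) => h1 i
  simp only [Finset.sum_add_distrib, Finset.sum_sub_distrib, ← Finset.mul_sum,
    ← Finset.sum_mul] at h4
  rw [h2] at h4
  have h5 : ∑ j, 2 * r * (∑ i ∈ G.neighborFinset j, z i) * (x j - z j) =
      2 * r * ∑ j, (∑ i ∈ G.neighborFinset j, z i) * x j -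
        2 * r * ∑ j, (∑ i ∈ G.neighborFinset j, z i) * z j := by
    simp only [Finset.mul_sum, ← Finset.sum_sub_distrib]
    refine Finset.sum_congr rfl fun j _ => ?_
    simp only [Finset.mul_sum, ← Finset.sum_sub_distrib, Finset.sum_mul, mul_sub, mul_assoc]
  rw [h5, energy_eq, h3]
  simp only [sqMass, volume]
  linarith

end IsStep

lemma isStep_blackProportion (init : V → Bool) (h : ℕ → V → Bool) (t : ℕ) :
    IsStep G t (blackProportion G init h t) (blackProportion G init h (t + 1))
      fun j => blackValue (h t j) where
  mem_Icc i := blackProportion_mem_Icc G init h t i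
  draw_mem_Icc _ := blackValue_mem_Icc _
  eq i := blackProportion_succ G init h t i

end Deterministic

/-- The mean of one coordinate under a product of Bernoulli laws. -/
lemma sum_blackValue_mul_prod {V : Type*} [Fintype V] [DecidableEq V] (p : V → ℝ) (j : V) :
    ∑ x : V → Bool, (∏ i, if x i = true then p i else 1 - p i) * blackValue (x j) = p j := by
  have h1 : ∀ x : V → Bool, (∏ i, if x i = true then p i else 1 - p i) * blackValue (x j) =
      ∏ i, (if x i = true then p i else 1 - p i) * if i = j then blackValue (x i) else 1 := by
    intro x
    rw [Finset.prod_mul_distrib]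
    simp
  simp only [h1]
  -- By distributivity the sum factors over the coordinates; each one other than `j` contributes `p
  -- i + (1 - p i) = 1`.
  rw [← Fintype.prod_sum (f := fun i b =>
    (if b = true then p i else 1 - p i) * if i = j then blackValue b else 1)]
  rw [Finset.prod_eq_single j]
  · simp [blackValue]
  · intro i _ hi
    simp [hi]
  · simp

/-! ### Conditional law of the draws given the past. -/

section Prediction

variable {V Ω : Type*} {θ : Ω → Bool} {σ : Ω → V → Bool} {X : ℕ → Ω → V → Bool}

/-- The state, the signals and the draws before time `t`. -/
def pastUntil (θ : Ω → Bool) (σ : Ω → V → Bool) (X : ℕ → Ω → V → Bool) (t : ℕ) (ω : Ω) :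
    Bool × (V → Bool) × (Fin t → V → Bool) :=
  (θ ω, σ ω, fun k => X k ω)

/-- The event that the state, the signals and the draws before time `t` are the given ones. -/
def cylinder (θ : Ω → Bool) (σ : Ω → V → Bool) (X : ℕ → Ω → V → Bool) (t : ℕ) (s : Bool)
    (c : V → Bool) (h : ℕ → V → Bool) : Set Ω :=
  {ω | θ ω = s ∧ σ ω = c ∧ ∀ k < t, X k ω = h k}

lemma cylinder_eq_preimage (t : ℕ) (s : Bool) (c : V → Bool) (h : ℕ → V → Bool) :
    cylinder θ σ X t s c h = pastUntil θ σ X t ⁻¹' {(s, c, fun k : Fin t => h k)} := by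
  ext ω
  simp only [cylinder, pastUntil, mem_ofPred_eq, mem_preimage, mem_singleton_iff, Prod.mk.injEq,
    funext_iff (f := fun k : Fin t => X k ω), Fin.forall_iff]

lemma exists_preimage_eq_cylinder (t : ℕ) (a : Bool × (V → Bool) × (Fin t → V → Bool)) :
    ∃ h : ℕ → V → Bool, pastUntil θ σ X t ⁻¹' {a} = cylinder θ σ X t a.1 a.2.1 h := by
  -- The cylinder ignores times from `t` on, so the value there is arbitrary.
  refine ⟨fun k => if hk : k < t then a.2.2 ⟨k, hk⟩ else fun _ => false, ?_⟩
  rw [cylinder_eq_preimage]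
  simp

variable [Fintype V] {G : SimpleGraph V} [DecidableRel G.Adj]

lemma belief_eq_of_mem_cylinder {t : ℕ} {s : Bool} {c : V → Bool} {h : ℕ → V → Bool} {ω : Ω}
    (hω : ω ∈ cylinder θ σ X t s c h) (i : V) :
    belief G θ σ X t i ω = blackProportion G (initialColour s c) h t i := by
  obtain ⟨h1, h2, h3⟩ := hω
  rw [belief, h1, h2]
  exact blackProportion_congr G _ t h3 i

lemma belief_mem_Icc (t : ℕ) (i : V) (ω : Ω) : belief G θ σ X t i ω ∈ Icc (0 : ℝ) 1 :=
  blackProportion_mem_Icc G _ _ t i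

lemma isStep_belief (t : ℕ) (ω : Ω) :
    IsStep G t (fun i => belief G θ σ X t i ω) (fun i => belief G θ σ X (t + 1) i ω)
      fun j => blackValue (X t ω j) :=
  isStep_blackProportion _ _ t

variable [mΩ : MeasurableSpace Ω] {α : ℝ} {μ : Measure Ω}

namespace IsUrnProcess

lemma measurable_pastUntil (hX : IsUrnProcess G α μ θ σ X) (t : ℕ) :
    Measurable (pastUntil θ σ X t) :=
  hX.measurable_state.prodMk
    (hX.measurable_signal.prodMk (measurable_pi_lambda _ fun k => hX.measurable_draw k))

/-- The information available at time `t`. -/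
def filtration (hX : IsUrnProcess G α μ θ σ X) : Filtration ℕ mΩ where
  seq t := MeasurableSpace.comap (pastUntil θ σ X t) inferInstance
  mono' s t hst := by
    rintro _ ⟨A, hA, rfl⟩
    refine ⟨(fun a : Bool × (V → Bool) × (Fin t → V → Bool) =>
      (a.1, a.2.1, fun k : Fin s => a.2.2 (Fin.castLE hst k))) ⁻¹' A, ?_, rfl⟩
    exact (by fun_prop : Measurable _) hA
  le' t := (hX.measurable_pastUntil t).comap_le

lemma measurable_of_comp_pastUntil (hX : IsUrnProcess G α μ θ σ X) {t : ℕ} {β : Type*}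
    [MeasurableSpace β] (g : Bool × (V → Bool) × (Fin t → V → Bool) → β) :
    Measurable[hX.filtration t] fun ω => g (pastUntil θ σ X t ω) :=
  (measurable_of_finite g).comp (comap_measurable (pastUntil θ σ X t))

lemma measurableSet_cylinder (hX : IsUrnProcess G α μ θ σ X) (t : ℕ) (s : Bool) (c : V → Bool)
    (h : ℕ → V → Bool) : MeasurableSet[hX.filtration t] (cylinder θ σ X t s c h) := by
  rw [cylinder_eq_preimage]
  exact ⟨_, MeasurableSet.singleton _, rfl⟩

lemma measurable_belief (hX : IsUrnProcess G α μ θ σ X) (t : ℕ) (i : V) :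
    Measurable[hX.filtration t] (belief G θ σ X t i) := by
  have h := hX.measurable_of_comp_pastUntil (t := t)
    fun a => blackProportion G (initialColour a.1 a.2.1)
      (fun k => if hk : k < t then a.2.2 ⟨k, hk⟩ else fun _ => false) t i
  convert h using 1
  ext ω
  exact blackProportion_congr G _ t (fun k hk => by simp [pastUntil, hk]) i

lemma measurable_blackValue_draw (hX : IsUrnProcess G α μ θ σ X) (t : ℕ) (j : V) :
    Measurable fun ω => blackValue (X t ω j) :=
  (measurable_of_finite blackValue).comp ((measurable_pi_apply j).comp (hX.measurable_draw t))

lemma integrable_blackValue_draw [IsFiniteMeasure μ] (hX : IsUrnProcess G α μ θ σ X) (t : ℕ)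
    (j : V) : Integrable (fun ω => blackValue (X t ω j)) μ :=
  Integrable.of_mem_Icc 0 1 (hX.measurable_blackValue_draw t j).aemeasurable
    (.of_forall fun _ => blackValue_mem_Icc _)

lemma measureReal_cylinder_succ (hX : IsUrnProcess G α μ θ σ X) (t : ℕ) (s : Bool)
    (c : V → Bool) (h : ℕ → V → Bool) :
    μ.real (cylinder θ σ X (t + 1) s c h) = μ.real (cylinder θ σ X t s c h) *
      ∏ i, (if h t i = true then blackProportion G (initialColour s c) h t i
          else 1 - blackProportion G (initialColour s c) h t i) := by
  rw [cylinder, cylinder, ← hX.draw_law]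
  simp only [Nat.lt_succ_iff]

/-- Overwriting `h t` by `x` reduces this to a longer cylinder: the proportions at time `t` depend
only on earlier draws, so they are unaffected. -/
lemma measureReal_cylinder_inter_draw (hX : IsUrnProcess G α μ θ σ X) (t : ℕ) (s : Bool)
    (c : V → Bool) (h : ℕ → V → Bool) (x : V → Bool) :
    μ.real (cylinder θ σ X t s c h ∩ {ω | X t ω = x}) = μ.real (cylinder θ σ X t s c h) *
      ∏ i, (if x i = true then blackProportion G (initialColour s c) h t i
          else 1 - blackProportion G (initialColour s c) h t i) := by
  set h' := Function.update h t x
  have hh : ∀ k < t, h' k = h k := fun k hk => Function.update_of_ne hk.ne _ _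
  have h1 : cylinder θ σ X t s c h = cylinder θ σ X t s c h' := by
    ext ω
    simp +contextual only [cylinder, mem_ofPred_eq, hh]
  have h2 : cylinder θ σ X t s c h ∩ {ω | X t ω = x} = cylinder θ σ X (t + 1) s c h' := by
    rw [h1]
    ext ω
    simp only [cylinder, mem_inter_iff, mem_ofPred_eq, Nat.forall_lt_succ_right, and_assoc]
    simp [h']
  rw [h2, hX.measureReal_cylinder_succ, h1]
  simp only [blackProportion_congr G _ t hh, h', Function.update_self]

lemma setIntegral_cylinder_blackValue [IsFiniteMeasure μ] (hX : IsUrnProcess G α μ θ σ X)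
    (t : ℕ) (s : Bool) (c : V → Bool) (h : ℕ → V → Bool) (j : V) :
    ∫ ω in cylinder θ σ X t s c h, blackValue (X t ω j) ∂μ =
      μ.real (cylinder θ σ X t s c h) * blackProportion G (initialColour s c) h t j := by
  classical
  have hm := hX.measurable_draw t
  have hA := hX.filtration.le t _ (hX.measurableSet_cylinder t s c h)
  have h1 := integral_map (μ := μ.restrict (cylinder θ σ X t s c h)) hm.aemeasurable
    (f := fun x : V → Bool => blackValue (x j)) (measurable_of_finite _).aestronglyMeasurable
  rw [← h1, integral_fintype (Integrable.of_finite), ← sum_blackValue_mul_prod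
    (fun i => blackProportion G (initialColour s c) h t i) j, Finset.mul_sum]
  refine Finset.sum_congr rfl fun x _ => ?_
  rw [map_measureReal_apply hm (MeasurableSet.singleton x),
    measureReal_restrict_apply (hm (MeasurableSet.singleton x)), inter_comm, smul_eq_mul,
    ← mul_assoc, ← hX.measureReal_cylinder_inter_draw]
  rfl

/-- Given the past, the expected number of black balls drawn by an agent is the proportion of black
balls in its urn. -/
lemma setIntegral_mul_blackValue_sub_belief [IsFiniteMeasure μ]
    (hX : IsUrnProcess G α μ θ σ X) {t : ℕ} {A : Set Ω} (hA : MeasurableSet[hX.filtration t] A)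
    {F : Ω → ℝ} (hF : Measurable[hX.filtration t] F) (j : V) :
    ∫ ω in A, F ω * (blackValue (X t ω j) - belief G θ σ X t j ω) ∂μ = 0 := by
  classical
  obtain ⟨f, -, rfl⟩ := hF.exists_eq_measurable_comp
  obtain ⟨S, -, rfl⟩ := hA
  have hfib : ∀ a, MeasurableSet (pastUntil θ σ X t ⁻¹' {a}) := fun a =>
    hX.measurable_pastUntil t (MeasurableSet.singleton a)
  have key : ∀ a, EqOn
      (fun ω => (f ∘ pastUntil θ σ X t) ω * (blackValue (X t ω j) - belief G θ σ X t j ω))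
      (fun ω => f a * (blackValue (X t ω j) - belief G θ σ X t j ω))
      (pastUntil θ σ X t ⁻¹' {a}) := by
    rintro a ω rfl
    rfl
  have hint : Integrable (fun ω => blackValue (X t ω j) - belief G θ σ X t j ω) μ :=
    (hX.integrable_blackValue_draw t j).sub (Integrable.of_mem_Icc 0 1
      ((hX.measurable_belief t j).mono (hX.filtration.le t) le_rfl).aemeasurable
        (.of_forall fun ω => belief_mem_Icc t j ω))
  -- The past takes finitely many values, so the event is a finite disjoint union of cylinders, on
  -- each of which the multiplier and the proportion are constant.
  have hS : pastUntil θ σ X t ⁻¹' S = ⋃ a ∈ S.toFinset, pastUntil θ σ X t ⁻¹' {a} := by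
    ext ω
    simp
  rw [hS, integral_biUnion_finset _ (fun a _ => hfib a)]
  · refine Finset.sum_eq_zero fun a _ => ?_
    rw [setIntegral_congr_fun (hfib a) (key a), integral_const_mul]
    obtain ⟨h, hh⟩ := exists_preimage_eq_cylinder (θ := θ) (σ := σ) (X := X) t a
    have h2 : EqOn (belief G θ σ X t j)
        (fun _ => blackProportion G (initialColour a.1 a.2.1) h t j)
        (pastUntil θ σ X t ⁻¹' {a}) := fun ω hω => belief_eq_of_mem_cylinder (hh ▸ hω) j
    rw [integral_sub (hX.integrable_blackValue_draw t j).integrableOn]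
    · rw [setIntegral_congr_fun (hfib a) h2, hh, hX.setIntegral_cylinder_blackValue]
      simp
    · exact (integrableOn_const (by finiteness)).congr_fun h2.symm (hfib a)
  · intro a _ b _ hab
    exact Disjoint.preimage _ (disjoint_singleton.2 hab)
  · exact fun a _ => (hint.const_mul _).integrableOn.congr_fun (key a).symm (hfib a)

end IsUrnProcess

end Prediction

/-! ### Bounded supermartingales up to summable errors. -/

section AlmostSupermartingale

variable {Ω : Type*} [mΩ : MeasurableSpace Ω]

/-- `U` is a bounded adapted process which loses `R t ≥ 0` in mean between the times `t` and
`t + 1`, up to a gain of at most `C / (t + 1) ^ 2`. -/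
structure IsAlmostSupermartingale (ℱ : Filtration ℕ mΩ) (μ : Measure Ω) (U R : ℕ → Ω → ℝ)
    (B C : ℝ) : Prop where
  measurable : ∀ t, Measurable[ℱ t] (U t)
  abs_bound : ∀ t ω, |U t ω| ≤ B
  gain_nonneg : 0 ≤ C
  loss_nonneg : ∀ t ω, 0 ≤ R t ω
  drift : ∀ t A, MeasurableSet[ℱ t] A → ∫ ω in A, U (t + 1) ω ∂μ ≤
    ∫ ω in A, U t ω ∂μ - ∫ ω in A, R t ω ∂μ + C * (1 / ((t : ℝ) + 1)) ^ 2 * μ.real A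

namespace IsAlmostSupermartingale

variable {ℱ : Filtration ℕ mΩ} {μ : Measure Ω} {U R : ℕ → Ω → ℝ} {B C : ℝ}

/-- The correction `2 * C / (t + 1)` drops by `2 * C / ((t + 1) * (t + 2))` in one step, which
absorbs the gain `C / (t + 1) ^ 2`. -/
lemma setIntegral_add_le (h : IsAlmostSupermartingale ℱ μ U R B C) (t : ℕ) {A : Set Ω}
    (hA : MeasurableSet[ℱ t] A) :
    ∫ ω in A, U (t + 1) ω ∂μ + 2 * C / ((t : ℝ) + 1 + 1) * μ.real A + ∫ ω in A, R t ω ∂μ ≤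
      ∫ ω in A, U t ω ∂μ + 2 * C / ((t : ℝ) + 1) * μ.real A := by
  have h1 := h.drift t A hA
  have h2 : C * (1 / ((t : ℝ) + 1)) ^ 2 ≤ 2 * C / ((t : ℝ) + 1) - 2 * C / ((t : ℝ) + 1 + 1) := by
    have hC := h.gain_nonneg
    have ht : (0 : ℝ) ≤ t := Nat.cast_nonneg t
    have h3 : 2 * C / ((t : ℝ) + 1) - 2 * C / ((t : ℝ) + 1 + 1) - C * (1 / ((t : ℝ) + 1)) ^ 2 =
        C * t / ((t + 1) ^ 2 * (t + 1 + 1)) := by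
      field_simp
      ring
    have h4 : 0 ≤ C * t / (((t : ℝ) + 1) ^ 2 * (t + 1 + 1)) := by positivity
    linarith
  have h5 := mul_le_mul_of_nonneg_right h2 (measureReal_nonneg (μ := μ) (s := A))
  rw [sub_mul] at h5
  linarith

variable [IsFiniteMeasure μ]

lemma integrable (h : IsAlmostSupermartingale ℱ μ U R B C) (t : ℕ) : Integrable (U t) μ :=
  Integrable.of_mem_Icc (-B) B ((h.measurable t).mono (ℱ.le t) le_rfl).aemeasurable
    (.of_forall fun ω => abs_le.1 (h.abs_bound t ω))

lemma supermartingale (h : IsAlmostSupermartingale ℱ μ U R B C) :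
    Supermartingale (fun t ω => U t ω + 2 * C / ((t : ℝ) + 1)) ℱ μ := by
  refine supermartingale_of_setIntegral_succ_le
    (fun t => ((h.measurable t).add_const _).stronglyMeasurable)
    (fun t => (h.integrable t).add (integrable_const _)) fun t A hA => ?_
  rw [integral_add (h.integrable _).integrableOn (integrable_const _).integrableOn,
    integral_add (h.integrable _).integrableOn (integrable_const _).integrableOn,
    setIntegral_const, setIntegral_const, smul_eq_mul, smul_eq_mul, mul_comm (μ.real A),
    mul_comm (μ.real A)]
  have h1 := h.setIntegral_add_le t hA
  have h2 : 0 ≤ ∫ ω in A, R t ω ∂μ := integral_nonneg fun ω => h.loss_nonneg t ω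
  push_cast
  linarith

/-- The bound is uniform in `n` and its excess vanishes as `t` grows; this is what keeps the urns
near a value once they are there. -/
lemma setIntegral_le (h : IsAlmostSupermartingale ℱ μ U R B C) {t n : ℕ} (htn : t ≤ n)
    {A : Set Ω} (hA : MeasurableSet[ℱ t] A) :
    ∫ ω in A, U n ω ∂μ ≤ ∫ ω in A, U t ω ∂μ + 2 * C / ((t : ℝ) + 1) * μ.real A := by
  have h1 := h.supermartingale.setIntegral_le htn hA
  rw [integral_add (h.integrable _).integrableOn (integrable_const _).integrableOn,
    integral_add (h.integrable _).integrableOn (integrable_const _).integrableOn,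
    setIntegral_const, setIntegral_const, smul_eq_mul, smul_eq_mul, mul_comm (μ.real A),
    mul_comm (μ.real A)] at h1
  have h2 : 0 ≤ 2 * C / ((n : ℝ) + 1) * μ.real A := by
    have := h.gain_nonneg
    positivity
  linarith

/-- Doob's theorem applies to the negative of the corrected process, an `L¹`-bounded submartingale,
and the correction tends to zero. -/
lemma exists_ae_tendsto (h : IsAlmostSupermartingale ℱ μ U R B C) :
    ∃ L : Ω → ℝ, Measurable L ∧ ∀ᵐ ω ∂μ, Tendsto (fun t => U t ω) atTop (𝓝 (L ω)) := by
  have hC := h.gain_nonneg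
  have hbdd : ∀ n, eLpNorm ((-fun t ω => U t ω + 2 * C / ((t : ℝ) + 1)) n) 1 μ ≤
      ((μ univ * ENNReal.ofReal (B + 2 * C)).toNNReal : ENNReal) := by
    intro n
    rw [ENNReal.coe_toNNReal (by finiteness)]
    refine (eLpNorm_le_of_ae_bound (C := B + 2 * C) (.of_forall fun ω => ?_)).trans (by simp)
    have h1 : 2 * C / ((n : ℝ) + 1) ≤ 2 * C := div_le_self (by positivity) (by simp)
    have h2 : 0 ≤ 2 * C / ((n : ℝ) + 1) := by positivity
    simp only [Pi.neg_apply, norm_neg, Real.norm_eq_abs]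
    exact (abs_add_le _ _).trans (add_le_add (h.abs_bound n ω) (by rwa [abs_of_nonneg h2]))
  have h1 := h.supermartingale.neg.exists_ae_tendsto_of_bdd hbdd
  refine measurable_limit_of_tendsto_metrizable_ae (fun t => (h.integrable t).aemeasurable) ?_
  filter_upwards [h1] with ω ⟨c, hω⟩
  have h2 : Tendsto (fun t : ℕ => 2 * C / ((t : ℝ) + 1)) atTop (𝓝 0) := by
    simpa [div_eq_mul_inv] using tendsto_one_div_add_atTop_nhds_zero_nat.const_mul (2 * C)
  exact ⟨-c - 0, by simpa using hω.neg.sub h2⟩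

lemma summable_integral_loss (h : IsAlmostSupermartingale ℱ μ U R B C) :
    Summable fun t => ∫ ω, R t ω ∂μ := by
  have h0 : ∀ n, ∑ t ∈ Finset.range n, ∫ ω, R t ω ∂μ ≤
      ∫ ω, U 0 ω ∂μ + 2 * C * μ.real univ -
        (∫ ω, U n ω ∂μ + 2 * C / ((n : ℝ) + 1) * μ.real univ) := by
    intro n
    induction n with
    | zero => simp
    | succ n ih =>
      have := h.setIntegral_add_le n MeasurableSet.univ
      simp only [Measure.restrict_univ] at this
      rw [Finset.sum_range_succ]
      push_cast
      linarith
  refine summable_of_sum_range_le (c := ∫ ω, U 0 ω ∂μ + 2 * C * μ.real univ + B * μ.real univ)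
    (fun t => integral_nonneg fun ω => h.loss_nonneg t ω) fun n => (h0 n).trans ?_
  have h1 : |∫ ω, U n ω ∂μ| ≤ B * μ.real univ :=
    norm_integral_le_of_norm_le_const (f := U n) (.of_forall fun ω => h.abs_bound n ω)
  have h2 : 0 ≤ 2 * C / ((n : ℝ) + 1) * μ.real univ := by
    have := h.gain_nonneg
    positivity
  linarith [neg_abs_le (∫ ω, U n ω ∂μ)]

end IsAlmostSupermartingale

end AlmostSupermartingale

/-! ### The mass, its squared deviation and the square mass as almost supermartingales. -/

section Potentials

variable {V Ω : Type*} [Fintype V] {G : SimpleGraph V} [DecidableRel G.Adj]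
  {θ : Ω → Bool} {σ : Ω → V → Bool} {X : ℕ → Ω → V → Bool} [mΩ : MeasurableSpace Ω]
  {α : ℝ} {μ : Measure Ω}

namespace IsUrnProcess

lemma integrable_of_measurable_filtration [IsFiniteMeasure μ]
    (hX : IsUrnProcess G α μ θ σ X) {t : ℕ} {F : Ω → ℝ}
    (hF : Measurable[hX.filtration t] F) : Integrable F μ := by
  obtain ⟨f, -, rfl⟩ := hF.exists_eq_measurable_comp
  exact Integrable.comp_measurable (Integrable.of_finite) (hX.measurable_pastUntil t)

/-- A bounded function of the urns which decreases pointwise up to martingale increments. -/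
lemma isAlmostSupermartingale [IsFiniteMeasure μ] (hX : IsUrnProcess G α μ θ σ X)
    {U R : ℕ → Ω → ℝ} {B C : ℝ}
    (F : ℕ → V → Ω → ℝ) (hU : ∀ t, Measurable[hX.filtration t] (U t))
    (hR : ∀ t, Measurable[hX.filtration t] (R t))
    (hF : ∀ t j, Measurable[hX.filtration t] (F t j)) (hB : ∀ t ω, |U t ω| ≤ B) (hC : 0 ≤ C)
    (hR0 : ∀ t ω, 0 ≤ R t ω)
    (h : ∀ t ω, U (t + 1) ω ≤ U t ω - R t ω +
      ∑ j, F t j ω * (blackValue (X t ω j) - belief G θ σ X t j ω) +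
        C * (1 / ((t : ℝ) + 1)) ^ 2) :
    IsAlmostSupermartingale hX.filtration μ U R B C where
  measurable := hU
  abs_bound := hB
  gain_nonneg := hC
  loss_nonneg := hR0
  drift t A hA := by
    classical
    have iU := fun t => hX.integrable_of_measurable_filtration (hU t)
    have iR := hX.integrable_of_measurable_filtration (hR t)
    have iF : ∀ j, Integrable
        (fun ω => F t j ω * (blackValue (X t ω j) - belief G θ σ X t j ω)) μ := by
      intro j
      obtain ⟨f, -, hf⟩ := (hF t j).exists_eq_measurable_comp
      -- The multiplier factors through the finite set of pasts, so it is bounded without further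
      -- assumption.
      have hb : ∀ ω, |F t j ω| ≤ ∑ a, |f a| := fun ω => by
        rw [hf]
        exact Finset.single_le_sum (f := fun a => |f a|) (fun _ _ => abs_nonneg _)
          (Finset.mem_univ (pastUntil θ σ X t ω))
      exact ((hX.integrable_blackValue_draw t j).sub
        (hX.integrable_of_measurable_filtration (hX.measurable_belief t j))).bdd_mul
          (((hF t j).mono (hX.filtration.le t) le_rfl).aestronglyMeasurable) (.of_forall hb)
    have iS := integrable_finsetSum Finset.univ fun j _ => iF j
    have iUR : Integrable (fun ω => U t ω - R t ω) μ := (iU t).sub iR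
    have iURS : Integrable (fun ω => U t ω - R t ω +
        ∑ j, F t j ω * (blackValue (X t ω j) - belief G θ σ X t j ω)) μ := iUR.add iS
    calc ∫ ω in A, U (t + 1) ω ∂μ
        ≤ ∫ ω in A, (U t ω - R t ω +
            ∑ j, F t j ω * (blackValue (X t ω j) - belief G θ σ X t j ω) +
              C * (1 / ((t : ℝ) + 1)) ^ 2) ∂μ :=
          setIntegral_mono (iU _).integrableOn
            (iURS.add (integrable_const _)).integrableOn (h t)
      _ = _ := by
          rw [integral_add iURS.integrableOn (integrable_const _),
            integral_add iUR.integrableOn iS.integrableOn,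
            integral_sub (iU t).integrableOn iR.integrableOn,
            integral_finsetSum _ fun j _ => (iF j).integrableOn]
          simp only [hX.setIntegral_mul_blackValue_sub_belief hA (hF t _),
            Finset.sum_const_zero, add_zero, setIntegral_const, smul_eq_mul]
          ring

lemma measurable_mass (hX : IsUrnProcess G α μ θ σ X) (t : ℕ) :
    Measurable[hX.filtration t] fun ω => mass G fun i => belief G θ σ X t i ω :=
  Finset.measurable_fun_sum _ fun i _ => (hX.measurable_belief t i).const_mul _

lemma isAlmostSupermartingale_mass [IsFiniteMeasure μ] (hX : IsUrnProcess G α μ θ σ X) :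
    IsAlmostSupermartingale hX.filtration μ
      (fun t ω => mass G fun i => belief G θ σ X t i ω) (fun _ _ => 0) (volume G)
      (volume G) := by
  refine hX.isAlmostSupermartingale (fun t j _ => 1 / ((t : ℝ) + 1) * G.degree j)
    hX.measurable_mass (fun _ => measurable_const) (fun _ _ => measurable_const) (fun t ω => ?_)
    (volume_nonneg G) (fun _ _ => le_rfl) fun t ω => ?_
  · have := mass_mem_Icc G fun i => belief_mem_Icc (G := G) (θ := θ) (σ := σ) (X := X) t i ω
    rw [abs_of_nonneg this.1]
    exact this.2
  · simpa using (isStep_belief (G := G) (θ := θ) (σ := σ) (X := X) t ω).mass_le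

lemma isAlmostSupermartingale_mass_sub_sq [IsFiniteMeasure μ]
    (hX : IsUrnProcess G α μ θ σ X) {y : ℝ}
    (hy : y ∈ Icc 0 (volume G)) :
    IsAlmostSupermartingale hX.filtration μ
      (fun t ω => (mass G (fun i => belief G θ σ X t i ω) - y) ^ 2) (fun _ _ => 0)
      (volume G ^ 2) (3 * volume G ^ 2) := by
  refine hX.isAlmostSupermartingale
    (fun t j ω => 2 * (1 / ((t : ℝ) + 1)) * (mass G (fun i => belief G θ σ X t i ω) - y) *
      G.degree j)
    (fun t => ((hX.measurable_mass t).sub_const y).pow_const 2) (fun _ => measurable_const)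
    (fun t j => (((hX.measurable_mass t).sub_const y).const_mul _).mul_const _)
    (fun t ω => ?_) (by positivity) (fun _ _ => le_rfl) fun t ω => ?_
  · have := mass_mem_Icc G fun i => belief_mem_Icc (G := G) (θ := θ) (σ := σ) (X := X) t i ω
    rw [abs_of_nonneg (sq_nonneg _)]
    exact sq_le_sq' (by linarith [this.1, hy.2]) (by linarith [this.2, hy.1])
  · simpa using (isStep_belief (G := G) (θ := θ) (σ := σ) (X := X) t ω).mass_sub_sq_le hy

lemma isAlmostSupermartingale_sqMass [IsFiniteMeasure μ] (hX : IsUrnProcess G α μ θ σ X) :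
    IsAlmostSupermartingale hX.filtration μ
      (fun t ω => sqMass G fun i => belief G θ σ X t i ω)
      (fun t ω => 1 / ((t : ℝ) + 1) * energy G fun i => belief G θ σ X t i ω)
      (volume G) (3 * volume G) := by
  have hb := hX.measurable_belief
  refine hX.isAlmostSupermartingale
    (fun t j ω => 2 * (1 / ((t : ℝ) + 1)) * ∑ i ∈ G.neighborFinset j, belief G θ σ X t i ω)
    (fun t => Finset.measurable_fun_sum _ fun i _ => ((hb t i).pow_const 2).const_mul _)
    (fun t => Measurable.const_mul (Finset.measurable_fun_sum _ fun i _ =>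
      Finset.measurable_fun_sum _ fun j _ => ((hb t i).sub (hb t j)).pow_const 2) _)
    (fun t j => Measurable.const_mul (Finset.measurable_fun_sum _ fun i _ => hb t i) _)
    (fun t ω => ?_) (by have := volume_nonneg G; positivity)
    (fun t ω => mul_nonneg (by positivity) (energy_nonneg G _)) fun t ω => ?_
  · have := sqMass_mem_Icc G fun i => belief_mem_Icc (G := G) (θ := θ) (σ := σ) (X := X) t i ω
    rw [abs_of_nonneg this.1]
    exact this.2
  · simpa using (isStep_belief (G := G) (θ := θ) (σ := σ) (X := X) t ω).sqMass_le

end IsUrnProcess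

end Potentials

/-- A real sequence that is summable against the harmonic weights cannot dominate one with a
positive limit. -/
lemma nonpos_of_tendsto_of_summable_div {w a : ℕ → ℝ} {C l : ℝ}
    (hw : Tendsto w atTop (𝓝 l)) (hwa : ∀ t, w t ≤ C * a t)
    (ha : Summable fun t : ℕ => 1 / ((t : ℝ) + 1) * a t) : l ≤ 0 := by
  by_contra! hl
  obtain ⟨N, hN⟩ := eventually_atTop.1 (hw.eventually (lt_mem_nhds (half_lt_self hl)))
  have h1 : Summable fun t : ℕ => l / 2 * (1 / (((t + N : ℕ) : ℝ) + 1)) := by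
    refine Summable.of_nonneg_of_le (fun t => by positivity) (fun t => ?_)
      (((summable_nat_add_iff N).2 ha).mul_left C)
    calc l / 2 * (1 / (((t + N : ℕ) : ℝ) + 1))
        ≤ (C * a (t + N)) * (1 / (((t + N : ℕ) : ℝ) + 1)) := by
          gcongr
          exact (hN (t + N) (Nat.le_add_left _ _)).le.trans (hwa _)
      _ = _ := by ring
  rw [summable_mul_left_iff (by positivity),
    summable_nat_add_iff N (f := fun t : ℕ => 1 / ((t : ℝ) + 1))] at h1
  have h2 := (summable_nat_add_iff 1 (f := fun t : ℕ => 1 / (t : ℝ))).1 (by exact_mod_cast h1)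
  exact Real.not_summable_one_div_natCast h2

/-! ### Almost sure consensus. -/

section Convergence

variable {V Ω : Type*} [Fintype V] {G : SimpleGraph V} [DecidableRel G.Adj]

lemma one_le_degree [Nontrivial V] (hG : G.Connected) (i : V) : (1 : ℝ) ≤ G.degree i := by
  exact_mod_cast hG.preconnected.degree_pos_of_nontrivial i

lemma volume_pos [Nontrivial V] (hG : G.Connected) : 0 < volume G :=
  Finset.sum_pos (fun i _ => zero_lt_one.trans_le (one_le_degree hG i)) Finset.univ_nonempty

/-- If the weighted mass converges and the weighted variance tends to `0`, then all values converge
to the weighted mean. -/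
lemma tendsto_of_tendsto_mass [Nontrivial V] (hG : G.Connected) {z : ℕ → V → ℝ} {m : ℝ}
    (hm : Tendsto (fun t => mass G (z t)) atTop (𝓝 m))
    (hv : Tendsto (fun t => ∑ i, ∑ j, (G.degree i : ℝ) * G.degree j * (z t i - z t j) ^ 2) atTop
      (𝓝 0)) (i : V) : Tendsto (fun t => z t i) atTop (𝓝 (m / volume G)) := by
  have hD := volume_pos hG
  have hsq : ∀ j, Tendsto (fun t => (z t i - z t j) ^ 2) atTop (𝓝 0) := by
    refine fun j => squeeze_zero (fun t => sq_nonneg _) (fun t => ?_) hv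
    have hn : ∀ k l : V, 0 ≤ (G.degree k : ℝ) * G.degree l * (z t k - z t l) ^ 2 :=
      fun k l => by positivity
    calc (z t i - z t j) ^ 2 = 1 * 1 * (z t i - z t j) ^ 2 := by ring
      _ ≤ (G.degree i : ℝ) * G.degree j * (z t i - z t j) ^ 2 := by
        gcongr
        exacts [one_le_degree hG i, one_le_degree hG j]
      _ ≤ ∑ l, (G.degree i : ℝ) * G.degree l * (z t i - z t l) ^ 2 :=
        Finset.single_le_sum (fun l _ => hn i l) (Finset.mem_univ j)
      _ ≤ _ := Finset.single_le_sum
        (f := fun k => ∑ l, (G.degree k : ℝ) * G.degree l * (z t k - z t l) ^ 2)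
        (fun k _ => Finset.sum_nonneg fun l _ => hn k l) (Finset.mem_univ i)
  have hdiff : ∀ j, Tendsto (fun t => z t i - z t j) atTop (𝓝 0) := by
    intro j
    have h := (hsq j).sqrt
    simp only [Real.sqrt_sq_eq_abs, Real.sqrt_zero] at h
    exact tendsto_zero_iff_abs_tendsto_zero _ |>.2 h
  -- This sum is `volume * z i - mass`, so adding it to the mass isolates `z i`.
  have hsum : Tendsto (fun t => ∑ j, (G.degree j : ℝ) * (z t i - z t j)) atTop (𝓝 0) := by
    simpa using tendsto_finsetSum Finset.univ fun j _ => (hdiff j).const_mul (G.degree j : ℝ)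
  have h := (hm.add hsum).div_const (volume G)
  rw [add_zero] at h
  refine h.congr fun t => ?_
  rw [div_eq_iff hD.ne', mass, ← Finset.sum_add_distrib, volume, Finset.mul_sum]
  exact Finset.sum_congr rfl fun j _ => by ring

variable {θ : Ω → Bool} {σ : Ω → V → Bool} {X : ℕ → Ω → V → Bool} [mΩ : MeasurableSpace Ω]
  {α : ℝ} {μ : Measure Ω} [IsFiniteMeasure μ]

namespace IsUrnProcess

/-- By the variance identity `W` is a combination of the two convergent potentials, hence converges
almost surely. Its expectations are at most `C` times expected energies, which are summable against
`1 / (t + 1)`; divergence of the harmonic series forces the nonnegative limit to have mean zero. -/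
lemma ae_tendsto_sum_sq_sub (hX : IsUrnProcess G α μ θ σ X) (hG : G.Connected) :
    ∀ᵐ ω ∂μ, Tendsto (fun t => ∑ i, ∑ j, (G.degree i : ℝ) * G.degree j *
      (belief G θ σ X t i ω - belief G θ σ X t j ω) ^ 2) atTop (𝓝 0) := by
  set W : ℕ → Ω → ℝ := fun t ω => ∑ i, ∑ j, (G.degree i : ℝ) * G.degree j *
      (belief G θ σ X t i ω - belief G θ σ X t j ω) ^ 2
  obtain ⟨L, hL, hLt⟩ := hX.isAlmostSupermartingale_mass.exists_ae_tendsto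
  obtain ⟨S, hS, hSt⟩ := hX.isAlmostSupermartingale_sqMass.exists_ae_tendsto
  obtain ⟨C, -, hCW⟩ := exists_sum_sq_sub_le_mul_energy G hG
  have hW : ∀ᵐ ω ∂μ, Tendsto (fun t => W t ω) atTop
      (𝓝 (2 * volume G * S ω - 2 * L ω ^ 2)) := by
    filter_upwards [hLt, hSt] with ω h1 h2
    simp only [W, sum_degree_mul_degree_mul_sq_sub]
    exact (h2.const_mul _).sub ((h1.pow 2).const_mul _)
  have hWm : ∀ t, Measurable[hX.filtration t] (W t) := fun t =>
    Finset.measurable_fun_sum _ fun i _ => Finset.measurable_fun_sum _ fun j _ =>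
      (((hX.measurable_belief t i).sub (hX.measurable_belief t j)).pow_const 2).const_mul _
  have hW0 : ∀ t ω, 0 ≤ W t ω := fun t ω =>
    Finset.sum_nonneg fun i _ => Finset.sum_nonneg fun j _ => by positivity
  have hWb : ∀ t ω, ‖W t ω‖ ≤ 2 * volume G * volume G := by
    intro t ω
    rw [Real.norm_of_nonneg (hW0 t ω)]
    have h1 := (sqMass_mem_Icc G fun i =>
      belief_mem_Icc (G := G) (θ := θ) (σ := σ) (X := X) t i ω).2
    have h2 := volume_nonneg G
    simp only [W, sum_degree_mul_degree_mul_sq_sub]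
    nlinarith [sq_nonneg (mass G fun i => belief G θ σ X t i ω)]
  have hint := tendsto_integral_of_dominated_convergence (μ := μ) (F := W)
    (fun _ => 2 * volume G * volume G)
    (fun t => ((hWm t).mono (hX.filtration.le t) le_rfl).aestronglyMeasurable)
    (integrable_const _) (fun t => .of_forall (hWb t)) hW
  have hle : ∫ ω, (2 * volume G * S ω - 2 * L ω ^ 2) ∂μ ≤ 0 := by
    refine nonpos_of_tendsto_of_summable_div (C := C) hint
      (a := fun t => ∫ ω, energy G fun i => belief G θ σ X t i ω ∂μ) (fun t => ?_) ?_
    · rw [← integral_const_mul]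
      refine integral_mono (hX.integrable_of_measurable_filtration (hWm t))
        (Integrable.const_mul (hX.integrable_of_measurable_filtration (t := t) ?_) _)
        fun ω => hCW _
      exact Finset.measurable_fun_sum _ fun i _ => Finset.measurable_fun_sum _ fun j _ =>
        ((hX.measurable_belief t i).sub (hX.measurable_belief t j)).pow_const 2
    · simpa only [integral_const_mul] using hX.isAlmostSupermartingale_sqMass.summable_integral_loss
  have h0 : ∀ᵐ ω ∂μ, 0 ≤ 2 * volume G * S ω - 2 * L ω ^ 2 := by
    filter_upwards [hW] with ω hω
    exact ge_of_tendsto' hω fun t => hW0 t ω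
  have hb : ∀ᵐ ω ∂μ, 2 * volume G * S ω - 2 * L ω ^ 2 ∈ Icc 0 (2 * volume G * volume G) := by
    filter_upwards [hW, h0] with ω hω hω0
    exact ⟨hω0, le_of_tendsto' hω fun t => (le_abs_self _).trans (hWb t ω)⟩
  have hz := (integral_eq_zero_iff_of_nonneg_ae h0 (Integrable.of_mem_Icc _ _
    ((hS.const_mul _).sub ((hL.pow_const 2).const_mul _)).aemeasurable hb)).1
      (le_antisymm hle (integral_nonneg_of_ae h0))
  filter_upwards [hW, hz] with ω hω hω0
  rwa [hω0] at hω

/-- The urns of all agents have a common limit. -/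
theorem exists_common_limit [Nontrivial V] (hX : IsUrnProcess G α μ θ σ X) (hG : G.Connected) :
    ∃ Z : Ω → ℝ, Measurable Z ∧
      ∀ᵐ ω ∂μ, ∀ i, Tendsto (fun t => belief G θ σ X t i ω) atTop (𝓝 (Z ω)) := by
  obtain ⟨L, hL, hLt⟩ := hX.isAlmostSupermartingale_mass.exists_ae_tendsto
  refine ⟨fun ω => L ω / volume G, hL.div_const _, ?_⟩
  filter_upwards [hLt, hX.ae_tendsto_sum_sq_sub hG] with ω h1 h2 i
  exact tendsto_of_tendsto_mass hG h1 h2 i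

end IsUrnProcess

end Convergence

/-! ### Reaching every proportion with positive probability, and staying close to it. -/

section FullSupport

/-- A connected graph with at least two vertices has a two-colouring in which every vertex has a
neighbour of the other colour. -/
lemma exists_colouring_forall_exists_adj_ne {V : Type*} [Nontrivial V] {G : SimpleGraph V}
    (hG : G.Connected) : ∃ κ : V → Bool, ∀ i, ∃ j, G.Adj i j ∧ κ j ≠ κ i := by
  obtain ⟨r⟩ := hG.nonempty
  have parent : ∀ i ≠ r, ∃ j, G.Adj i j ∧ G.dist i r = G.dist j r + 1 := by
    intro i hi
    obtain ⟨p, hp⟩ := (hG.preconnected i r).exists_walk_length_eq_dist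
    cases p with
    | nil => exact absurd rfl hi
    | @cons _ j _ hij q =>
      refine ⟨j, hij, ?_⟩
      have h1 := SimpleGraph.dist_le q
      have h2 := hG.dist_triangle (u := i) (v := j) (w := r)
      have h3 := SimpleGraph.dist_le hij.toWalk
      simp only [SimpleGraph.Walk.length_cons, SimpleGraph.Walk.length_nil] at hp h3
      omega
  -- Colour by parity of the distance to a root: the next vertex on a geodesic to the root has the
  -- other parity, and the root has a neighbour at distance 1.
  refine ⟨fun i => decide (Even (G.dist i r)), fun i => ?_⟩
  by_cases hi : i = r
  · subst hi
    obtain ⟨j, hj⟩ := hG.preconnected.exists_adj_of_nontrivial i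
    refine ⟨j, hj, ?_⟩
    simp [SimpleGraph.dist_eq_one_iff_adj.2 hj.symm]
  · obtain ⟨j, hij, hd⟩ := parent i hi
    refine ⟨j, hij, ?_⟩
    simp only [hd, Nat.even_add_one, ne_eq, decide_eq_decide]
    tauto

variable {V Ω : Type*} [Fintype V] {G : SimpleGraph V} [DecidableRel G.Adj]

/-- At time 0 each agent can only draw its own ball, so a neighbour of the other colour supplies the
missing colour at time 1; balls are never removed. -/
lemma balls_succ_pos {init : V → Bool} {h : ℕ → V → Bool} (h0 : h 0 = init)
    (hinit : ∀ i, ∃ j, G.Adj i j ∧ init j ≠ init i) (c : Bool) (t : ℕ) (i : V) :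
    0 < balls G init h c (t + 1) i := by
  induction t with
  | zero =>
    simp only [balls, h0]
    by_cases hi : init i = c
    · simp [hi]
    · obtain ⟨j, hij, hj⟩ := hinit i
      have hjc : init j = c := by
        revert hi hj
        cases init i <;> cases init j <;> cases c <;> simp
      exact Nat.add_pos_right _ (Finset.card_pos.2 ⟨j, by simp [hij, hjc]⟩)
  | succ t ih => exact Nat.add_pos_left ih _

/-- The draws which reproduce the initial colours at time `0`, and are black for all agents before
time `K` and white from then on. -/
def uniformDraws (init : V → Bool) (K k : ℕ) (i : V) : Bool :=
  if k = 0 then init i else decide (k < K)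

/-- Only the initial ball and the forced first round cause a discrepancy. From time 1 on, the count
and `d * min (t + 1) K` grow by the same amount, so it stays constant. -/
lemma abs_balls_uniformDraws_sub_le (init : V → Bool) (K t : ℕ) (i : V) :
    |(balls G init (uniformDraws init K) true (t + 1) i : ℝ) -
      G.degree i * (min (t + 1) K : ℕ)| ≤ 1 + G.degree i := by
  induction t with
  | zero =>
    have h1 : (balls G init (uniformDraws init K) true (0 + 1) i : ℝ) ≤ 1 + G.degree i := by
      have := balls_true_add_balls_false G init (uniformDraws init K) (0 + 1) i
      exact_mod_cast (by omega : balls G init (uniformDraws init K) true (0 + 1) i ≤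
        1 + G.degree i)
    have h2 : (G.degree i : ℝ) * (min (0 + 1) K : ℕ) ≤ G.degree i :=
      mul_le_of_le_one_right (Nat.cast_nonneg _) (by exact_mod_cast min_le_left _ _)
    have h3 : (0 : ℝ) ≤ balls G init (uniformDraws init K) true (0 + 1) i := Nat.cast_nonneg _
    have h4 : (0 : ℝ) ≤ (G.degree i : ℝ) * (min (0 + 1) K : ℕ) := by positivity
    exact abs_le.2 ⟨by linarith, by linarith⟩
  | succ t ih =>
    have h1 : (balls G init (uniformDraws init K) true (t + 1 + 1) i : ℝ) -
        G.degree i * (min (t + 1 + 1) K : ℕ) =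
          balls G init (uniformDraws init K) true (t + 1) i -
            G.degree i * (min (t + 1) K : ℕ) := by
      rw [balls_true_succ]
      by_cases hK : t + 1 < K
      · rw [min_eq_left hK.le, min_eq_left (Nat.succ_le_of_lt hK)]
        simp [uniformDraws, blackValue, hK]
        ring
      · rw [min_eq_right (not_lt.1 hK), min_eq_right ((not_lt.1 hK).trans (Nat.le_succ _))]
        simp [uniformDraws, blackValue, hK]
    rwa [h1]

/-- Every proportion can be approximated by the urns of all agents at once. -/
lemma abs_blackProportion_uniformDraws_sub_le [Nontrivial V] (hG : G.Connected) (init : V → Bool)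
    {x : ℝ} (hx : x ∈ Icc (0 : ℝ) 1) {t : ℕ} (ht : 0 < t) (i : V) :
    |blackProportion G init (uniformDraws init ⌊x * t⌋₊) t i - x| ≤ 4 / t := by
  have hd := one_le_degree hG i
  have ht' : (0 : ℝ) < t := by exact_mod_cast ht
  have hb : |(balls G init (uniformDraws init ⌊x * t⌋₊) true t i : ℝ) -
      G.degree i * (⌊x * t⌋₊ : ℝ)| ≤ 1 + G.degree i := by
    obtain ⟨n, rfl⟩ := Nat.exists_eq_add_one.2 ht
    have h := abs_balls_uniformDraws_sub_le (G := G) init ⌊x * (n + 1 : ℕ)⌋₊ n i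
    rwa [min_eq_right] at h
    exact Nat.floor_le_of_le (mul_le_of_le_one_left (Nat.cast_nonneg _) hx.2)
  set b : ℝ := (balls G init (uniformDraws init ⌊x * t⌋₊) true t i : ℝ) with hbdef
  have hf1 := Nat.floor_le (mul_nonneg hx.1 ht'.le)
  have hf2 := Nat.lt_floor_add_one (x * t)
  have hpos : (0 : ℝ) < 1 + G.degree i * t := by positivity
  -- The errors are `1 + d` from the count, at most `d` from the floor and at most 1 from the term
  -- `x`; their sum `2 + 2 * d` is at most `4 * d` because `d ≥ 1`.
  have h1 : |b - x * (1 + G.degree i * t)| ≤ 4 * G.degree i := by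
    have h2 := abs_le.1 hb
    have h3 := mul_le_mul_of_nonneg_left hf1 (zero_le_one.trans hd)
    have h4 := mul_le_mul_of_nonneg_left hf2.le (zero_le_one.trans hd)
    exact abs_le.2 ⟨by linarith [h2.1, hx.2], by linarith [h2.2, hx.1]⟩
  rw [blackProportion_eq_div, ← hbdef, div_sub' hpos.ne', abs_div, abs_of_pos hpos, mul_comm _ x,
    div_le_div_iff₀ hpos ht']
  nlinarith

variable {θ : Ω → Bool} {σ : Ω → V → Bool} {X : ℕ → Ω → V → Bool} [mΩ : MeasurableSpace Ω]
  {α : ℝ} {μ : Measure Ω}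

namespace IsUrnProcess

/-- Every signal vector has positive probability, the time-0 draws are forced, and from time 1 on
every urn holds both colours, so no later draw is excluded. -/
lemma measureReal_cylinder_pos (hX : IsUrnProcess G α μ θ σ X) (hα : α ∈ Ioo (0 : ℝ) 1)
    {s : Bool} (hs : 0 < μ.real {ω | θ ω = s}) {c : V → Bool} {h : ℕ → V → Bool}
    (h0 : h 0 = initialColour s c)
    (hc : ∀ i, ∃ j, G.Adj i j ∧ initialColour s c j ≠ initialColour s c i) (t : ℕ) :
    0 < μ.real (cylinder θ σ X t s c h) := by
  induction t with
  | zero =>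
    have h1 : cylinder θ σ X 0 s c h = {ω | θ ω = s ∧ σ ω = c} := by simp [cylinder]
    rw [h1, hX.signal_law]
    refine mul_pos hs (Finset.prod_pos fun i _ => ?_)
    split_ifs
    exacts [hα.1, sub_pos.2 hα.2]
  | succ t ih =>
    rw [hX.measureReal_cylinder_succ]
    refine mul_pos ih (Finset.prod_pos fun i _ => ?_)
    cases t with
    | zero =>
      rw [h0, blackProportion]
      cases hi : initialColour s c i <;> simp [balls, hi]
    | succ t =>
      have h1 : (0 : ℝ) < balls G (initialColour s c) h true (t + 1) i := by
        exact_mod_cast balls_succ_pos h0 hc true t i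
      have h2 : (0 : ℝ) < balls G (initialColour s c) h false (t + 1) i := by
        exact_mod_cast balls_succ_pos h0 hc false t i
      rw [blackProportion]
      split_ifs
      · positivity
      · rw [sub_pos, div_lt_one (by positivity)]
        linarith

/-- With positive probability, all urns are close to a given proportion at a given time. -/
lemma exists_measurableSet_pos [IsProbabilityMeasure μ] [Nontrivial V]
    (hX : IsUrnProcess G α μ θ σ X) (hG : G.Connected) (hα : α ∈ Ioo (0 : ℝ) 1) {x : ℝ}
    (hx : x ∈ Icc (0 : ℝ) 1) {t : ℕ} (ht : 0 < t) :
    ∃ A, MeasurableSet[hX.filtration t] A ∧ 0 < μ.real A ∧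
      ∀ ω ∈ A, ∀ i, |belief G θ σ X t i ω - x| ≤ 4 / t := by
  obtain ⟨s, hs⟩ : ∃ s, 0 < μ.real {ω | θ ω = s} := by
    by_contra! hc
    have h1 : ∀ s, μ {ω | θ ω = s} = 0 := fun s =>
      (measureReal_eq_zero_iff).1 (le_antisymm (hc s) measureReal_nonneg)
    have h2 : (univ : Set Ω) = ⋃ s, {ω | θ ω = s} := by
      ext ω
      simp
    have h3 : μ univ = 0 := by
      rw [h2]
      exact measure_iUnion_null h1
    simp at h3
  obtain ⟨κ, hκ⟩ := exists_colouring_forall_exists_adj_ne hG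
  -- These signals differ from `s` exactly at the vertices which `κ` marks black, whichever state
  -- has positive prior.
  have hc : initialColour s (fun i => xor (κ i) s) = κ := by
    ext i
    cases hi : κ i <;> cases s <;> simp [initialColour, hi]
  refine ⟨cylinder θ σ X t s (fun i => xor (κ i) s) (uniformDraws κ ⌊x * t⌋₊),
    hX.measurableSet_cylinder _ _ _ _,
    hX.measureReal_cylinder_pos hα hs (by rw [hc]; rfl) (by rwa [hc]) t, fun ω hω i => ?_⟩
  rw [belief_eq_of_mem_cylinder hω, hc]
  exact abs_blackProportion_uniformDraws_sub_le hG κ hx ht i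

/-- The common limit is close to any given proportion with positive probability. -/
lemma measure_abs_limit_sub_lt_pos [IsProbabilityMeasure μ] [Nontrivial V]
    (hX : IsUrnProcess G α μ θ σ X) (hG : G.Connected) (hα : α ∈ Ioo (0 : ℝ) 1) {Z : Ω → ℝ}
    (hZm : Measurable Z)
    (hZ : ∀ᵐ ω ∂μ, ∀ i, Tendsto (fun t => belief G θ σ X t i ω) atTop (𝓝 (Z ω)))
    {x : ℝ} (hx : x ∈ Icc (0 : ℝ) 1) {ε : ℝ} (hε : 0 < ε) : 0 < μ {ω | |Z ω - x| < ε} := by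
  rw [pos_iff_ne_zero]
  intro hnull
  have hfar : ∀ᵐ ω ∂μ, ε ≤ |Z ω - x| := by
    rw [ae_iff]
    simpa only [not_le] using hnull
  have hD := volume_pos hG
  set D := volume G
  -- Per unit of mass of `A`, the squared deviation starts at no more than `(4 * D / t) ^ 2 ≤ 16 * D
  -- ^ 2 / t` and later gains at most `6 * D ^ 2 / t`. If the limit stayed `ε` away, this would give
  -- `ε ^ 2 ≤ 22 / t`.
  obtain ⟨t, ht⟩ := exists_nat_gt (22 / ε ^ 2)
  have ht0 : (0 : ℝ) < t := lt_trans (by positivity) ht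
  obtain ⟨A, hA, hApos, hAx⟩ := hX.exists_measurableSet_pos hG hα hx
    (by exact_mod_cast ht0 : 0 < t)
  have hmA := hX.filtration.le t A hA
  have hy : D * x ∈ Icc 0 D :=
    ⟨mul_nonneg hD.le hx.1, mul_le_of_le_one_right hD.le hx.2⟩
  have hsup := hX.isAlmostSupermartingale_mass_sub_sq hy
  have hlim : Tendsto (fun n => ∫ ω in A, (mass G (fun i => belief G θ σ X n i ω) - D * x) ^ 2 ∂μ)
      atTop (𝓝 (∫ ω in A, (D * Z ω - D * x) ^ 2 ∂μ)) := by
    refine tendsto_integral_of_dominated_convergence (fun _ => D ^ 2)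
      (fun n => (hsup.integrable n).integrableOn.aestronglyMeasurable) (integrable_const _)
      (fun n => .of_forall (hsup.abs_bound n)) (ae_restrict_of_ae ?_)
    filter_upwards [hZ] with ω hω
    have h1 : Tendsto (fun n => mass G fun i => belief G θ σ X n i ω) atTop (𝓝 (D * Z ω)) := by
      simp only [mass, D, volume, Finset.sum_mul]
      exact tendsto_finsetSum _ fun i _ => (hω i).const_mul _
    exact (h1.sub_const _).pow 2
  have hstart : ∫ ω in A, (mass G (fun i => belief G θ σ X t i ω) - D * x) ^ 2 ∂μ ≤
      (D * (4 / t)) ^ 2 * μ.real A := by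
    have h1 : ∀ ω ∈ A, (mass G (fun i => belief G θ σ X t i ω) - D * x) ^ 2 ≤
        (D * (4 / t)) ^ 2 := by
      intro ω hω
      refine sq_le_sq' (abs_le.1 ?_).1 (abs_le.1 ?_).2 <;>
      · simp only [mass, D, volume, Finset.sum_mul, ← Finset.sum_sub_distrib, ← mul_sub]
        refine (Finset.abs_sum_le_sum_abs _ _).trans (Finset.sum_le_sum fun i _ => ?_)
        rw [abs_mul, Nat.abs_cast]
        exact mul_le_mul_of_nonneg_left (hAx ω hω i) (Nat.cast_nonneg _)
    have h2 := setIntegral_mono_on (hsup.integrable t).integrableOn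
      (integrable_const ((D * (4 / t)) ^ 2)).integrableOn hmA h1
    rwa [setIntegral_const, smul_eq_mul, mul_comm (μ.real A)] at h2
  have hupper := le_of_tendsto hlim (eventually_atTop.2
    ⟨t, fun n hn => (hsup.setIntegral_le hn hA).trans (add_le_add_left hstart _)⟩)
  have hlower : (D * ε) ^ 2 * μ.real A ≤ ∫ ω in A, (D * Z ω - D * x) ^ 2 ∂μ := by
    have hbound : ∀ᵐ ω ∂μ, (D * Z ω - D * x) ^ 2 ∈ Icc 0 (D ^ 2) := by
      obtain ⟨i⟩ := hG.nonempty
      filter_upwards [hZ] with ω hω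
      have h0 : 0 ≤ Z ω := ge_of_tendsto' (hω i) fun t => (belief_mem_Icc t i ω).1
      have h1 : Z ω ≤ 1 := le_of_tendsto' (hω i) fun t => (belief_mem_Icc t i ω).2
      refine ⟨sq_nonneg _, ?_⟩
      rw [← mul_sub, mul_pow]
      refine mul_le_of_le_one_right (sq_nonneg D) ?_
      rw [sq_le_one_iff_abs_le_one]
      exact abs_le.2 ⟨by linarith [hx.2], by linarith [hx.1]⟩
    have hint := Integrable.of_mem_Icc _ _
      (((hZm.const_mul D).sub_const (D * x)).pow_const 2).aemeasurable hbound
    rw [mul_comm, ← smul_eq_mul, ← setIntegral_const]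
    refine setIntegral_mono_ae (integrable_const _).integrableOn hint.integrableOn ?_
    filter_upwards [hfar] with ω hω
    rw [← mul_sub, mul_pow, mul_pow, ← sq_abs (Z ω - x)]
    gcongr
  have hfin := hlower.trans hupper
  rw [← add_mul] at hfin
  have h1 := le_of_mul_le_mul_right hfin hApos
  have h2 : 2 * (3 * D ^ 2) / ((t : ℝ) + 1) ≤ D ^ 2 * (6 / t) := by
    have h0 : 2 * (3 * D ^ 2) / ((t : ℝ) + 1) ≤ 2 * (3 * D ^ 2) / t := by
      gcongr
      linarith
    exact h0.trans (le_of_eq (by ring))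
  have ht1 : (1 : ℝ) ≤ t := by exact_mod_cast (by exact_mod_cast ht0 : 0 < t)
  have h3 : (4 / (t : ℝ)) ^ 2 ≤ 16 / t := by
    rw [div_pow, div_le_div_iff₀ (by positivity) ht0]
    nlinarith
  have h4 : ε ^ 2 * D ^ 2 ≤ (22 / t) * D ^ 2 := by
    have h5 : (22 / (t : ℝ)) = 16 / t + 6 / t := by ring
    rw [h5]
    nlinarith [mul_le_mul_of_nonneg_left h3 (sq_nonneg D)]
  have h5 := le_of_mul_le_mul_right h4 (by positivity)
  rw [div_lt_iff₀ (by positivity)] at ht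
  rw [le_div_iff₀ ht0] at h5
  linarith

end IsUrnProcess

end FullSupport

end OpinionUrns

theorem theorem4 {V Ω : Type*} [Fintype V] [Nontrivial V] [MeasurableSpace Ω]
    (G : SimpleGraph V) [DecidableRel G.Adj] (hG : G.Connected)
    (α : ℝ) (hα : α ∈ Set.Ioo (0 : ℝ) 1)
    (μ : Measure Ω) [IsProbabilityMeasure μ]
    (θ : Ω → Bool) (σ : Ω → V → Bool) (X : ℕ → Ω → V → Bool)
    (hX : OpinionUrns.IsUrnProcess G α μ θ σ X) :
    ∃ Zbar : Ω → ℝ, Measurable Zbar ∧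
      (∀ᵐ ω ∂μ, ∀ i, Tendsto (fun t => OpinionUrns.belief G θ σ X t i ω) atTop (𝓝 (Zbar ω))) ∧
      (¬ ∃ c : ℝ, ∀ᵐ ω ∂μ, Zbar ω = c) ∧
      (μ.map Zbar).support = Set.Icc (0 : ℝ) 1 := by
  obtain ⟨Z, hZm, hZ⟩ := hX.exists_common_limit hG
  have hpos : ∀ x ∈ Icc (0 : ℝ) 1, ∀ ε > 0, 0 < μ {ω | |Z ω - x| < ε} := fun x hx ε hε =>
    hX.measure_abs_limit_sub_lt_pos hG hα hZm hZ hx hε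
  refine ⟨Z, hZm, hZ, ?_, Subset.antisymm ?_ ?_⟩
  · rintro ⟨c, hc⟩
    -- A constant limit would have to lie within `1 / 2` of both 0 and 1.
    have key : ∀ x ∈ Icc (0 : ℝ) 1, |c - x| < 1 / 2 := by
      intro x hx
      by_contra! hcx
      refine (hpos x hx (1 / 2) (by norm_num)).ne' ?_
      refine measure_mono_null (fun ω hω => ?_) (ae_iff.1 hc)
      rintro rfl
      exact not_lt.2 hcx hω
    have h0 := abs_lt.1 (key 0 (by simp))
    have h1 := abs_lt.1 (key 1 (by simp))
    linarith [h0.2, h1.1]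
  · refine Measure.support_subset_of_isClosed isClosed_Icc ?_
    rw [mem_ae_map_iff hZm.aemeasurable measurableSet_Icc]
    obtain ⟨i⟩ := hG.nonempty
    filter_upwards [hZ] with ω hω
    exact ⟨ge_of_tendsto' (hω i) fun t => (OpinionUrns.belief_mem_Icc t i ω).1,
      le_of_tendsto' (hω i) fun t => (OpinionUrns.belief_mem_Icc t i ω).2⟩
  · intro x hx
    rw [Measure.mem_support_iff_forall]
    intro U hU
    obtain ⟨ε, hε, hεU⟩ := Metric.mem_nhds_iff.1 hU
    refine (hpos x hx ε hε).trans_le ?_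
    refine le_trans (le_of_eq ?_) (measure_mono hεU)
    rw [Measure.map_apply hZm measurableSet_ball]
    rfl
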